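/- **Setting.** Let $(p_n)_{n\ge 0}$ be a sequence of positive numbers, decreasing monotonically to $0$, with $p_0=1$. The *infinite step billiard* with heights $(p_n)$ is the billiard in the table $\bigcup_{n\ge 0}[n,n+1]\times[0,p_n]$. For $\vartheta\in\,]0,\pi/2[$, its invariant surface $S(\vartheta)$ is obtained by unfolding four copies of the table: in coordinates $(X,Y)$ it is the region $\{|Y|\le p_n \text{ for } n\le |X|\le n+1\}$ in which $(X,p_n)$ is identified with $(X,-p_n)$ for $n<|X|<n+1$, and, for $k\ge 1$, the vertical wall points $(k,Y)$ and $(-k,Y)$, $p_k\le|Y|\le p_{k-1}$, are identified. On it the billiard flow is the straight-line motion with velocity $(\cos\vartheta,\sin\vartheta)$. Orbits that meet a vertex are continued by continuity from above; in particular, an orbit arriving at $X=n$ passes through the aperture $G_n=\{n\}\times[-p_n,p_n[$ if it arrives at a point of $G_n$, and hits a vertical wall otherwise. Let $L=\{0\}\times[-1,1[\;\simeq[-1,1[$, and let $E^{(n)}_\vartheta\subset L$ be the set of points whose forward orbit in the direction $\vartheta$ reaches $G_n$ without colliding with any vertical wall after its start. For $A\subset\mathbb R$, let $\mathrm{n.i.}(A)$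 be the least number of nonempty right-open intervals $[a,b[$ whose union is $A$. **Theorem.** Suppose that there is a $\lambda$ with $$0<\lambda<\lambda_0:=\frac{\sqrt6-1}{5}\qquad\text{and}\qquad p_{n+1}\le\lambda\,p_n\quad\text{for all } n\ge 0 .$$ Then for Lebesgue-almost every direction $\vartheta\in\,]0,\pi/2[$ there is a strictly increasing sequence $(n_j)$ of natural numbers such that $\mathrm{n.i.}(E^{(n_j)}_\vartheta)=1$ for all $j$, that is, each $E^{(n_j)}_\vartheta$ is a single nonempty interval $[a_j,b_j[\;\subset[-1,1[$. -/

import Mathlib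

open Real Set Filter Topology MeasureTheory

noncomputable section

/-- An infinite step billiard: its table is `⋃ n, [n, n+1] × [0, p n]`, where the heights `p n` are
positive, decrease monotonically to zero, and `p 0 = 1`. -/
structure StepBilliard where
  p : ℕ → ℝ
  pos : ∀ n, 0 < p n
  zero_eq_one : p 0 = 1
  antitone : Antitone p
  tendsto_zero : Tendsto p atTop (𝓝 0)

namespace StepBilliard

variable (B : StepBilliard)

/-- Four copies of the table, reflected in the axes, make up a planar region which meets the
vertical strip `m ≤ X < m + 1`, for `m : ℤ`, in a rectangle of half-height `height m`. -/
def height : ℤ → ℝ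
  | Int.ofNat k => B.p k
  | Int.negSucc k => B.p k

lemma height_pos (m : ℤ) : 0 < B.height m := by
  cases m with
  | ofNat k => exact B.pos k
  | negSucc k => exact B.pos k

/-- The top and the bottom side of the rectangle over `[m, m + 1]` are identified: the vertical
coordinate in this strip lives on a circle of length `2 * height m`, represented by the interval
`[-height m, height m)`. -/
def wrap (m : ℤ) (y : ℝ) : ℝ :=
  toIcoMod (mul_pos two_pos (B.height_pos m)) (-B.height m) y

/-- The invariant surface of the billiard flow in coordinates `(X, Y)`, with one representative
for each point. The upper sides are identified with the lower ones, and a point `(k, Y)` of a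
vertical wall at `X = k ≥ 1`, which is a point with `Y ∉ [-p k, p k)`, is identified with
`(-k, Y)`, the latter being the chosen representative. By the convention of continuity from
above, of the segment `X = k` the point `(k, -p k)` belongs to the opening and `(k, p k)` to the
wall. -/
def surface : Set (ℝ × ℝ) :=
  {z | z.2 ∈ Ico (-B.height ⌊z.1⌋) (B.height ⌊z.1⌋)}

/-- The vertical walls on the surface: the segment `X = 0`, and for `k ≥ 1` the points `(k, Y)`,
identified with `(-k, Y)`, with `Y` outside `[-p k, p k)`. -/
def walls : Set (ℝ × ℝ) :=
  {z ∈ B.surface | z.1 = 0 ∨ ∃ k : ℕ, 1 ≤ k ∧ z.1 = -(k : ℝ) ∧ z.2 ∉ Ico (-B.p k) (B.p k)}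

/-- The `n`-th aperture `{n} × [-p n, p n)`. -/
def aperture (n : ℕ) : Set (ℝ × ℝ) := {(n : ℝ)} ×ˢ Ico (-B.p n) (B.p n)

/-- The motion with slope `tan θ` from the left end `X = m` of one strip to the left end of the next
one. A state `(m, y)` stands for the point `(m, y)`. The trajectory arrives at `X = m + 1` with
vertical coordinate `y' = wrap m (y + tan θ)`. If `m + 1 ≥ 1` and `y'` lies outside
`[-p (m+1), p (m+1))`, it hits a vertical wall and goes on from `(-(m + 1), y')`; otherwise it goes
on from `(m + 1, y')`. -/
def cross (θ : ℝ) : ℤ × ℝ → ℤ × ℝ := fun e =>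
  open Classical in
  let y' := B.wrap e.1 (e.2 + tan θ)
  if 0 ≤ e.1 ∧ y' ∉ Ico (-B.height (e.1 + 1)) (B.height (e.1 + 1)) then (-(e.1 + 1), y')
  else (e.1 + 1, y')

/-- The unit speed billiard flow on the surface in the direction `θ ∈ (0, π/2)`, for times
`t ≥ 0`. Here `s` is the horizontal distance that the trajectory has covered at time `t`,
counted from the left end of the strip that contains the starting point `z`. -/
def flow (θ t : ℝ) (z : ℝ × ℝ) : ℝ × ℝ :=
  let s : ℝ := Int.fract z.1 + t * cos θ
  let e : ℤ × ℝ := (B.cross θ)^[⌊s⌋₊] (⌊z.1⌋, z.2 - Int.fract z.1 * tan θ)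
  let r : ℝ := s - ⌊s⌋₊
  (e.1 + r, B.wrap e.1 (e.2 + r * tan θ))

/-- The set `E_θ^(n)` of the points of `L = {0} × [-1, 1)`, identified with `[-1, 1)`, whose forward
orbit in the direction `θ` reaches the `n`-th aperture directly, that is, without colliding with
any vertical wall after the start. -/
def directSet (θ : ℝ) (n : ℕ) : Set ℝ :=
  {y | y ∈ Ico (-1 : ℝ) 1 ∧ ∃ t : ℝ, 0 ≤ t ∧ B.flow θ t (0, y) ∈ B.aperture n ∧
    ∀ s ∈ Ioc 0 t, B.flow θ s (0, y) ∉ B.walls}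

end StepBilliard

/-- The number of intervals of `A`: the least number of nonempty right-open intervals `[a, b)` whose
union is `A` (infinity if `A` is not such a finite union). -/
def numIntervals (A : Set ℝ) : ℕ∞ :=
  ⨅ (k : ℕ) (_ : ∃ a b : Fin k → ℝ, (∀ i, a i < b i) ∧ A = ⋃ i, Ico (a i) (b i)), (k : ℕ∞)

end

/-!
Write `τ = tan θ`. Pulling the aperture `G_n` back strip by strip, through rotations of the circles
`[-p k, p k)`, keeps it a single interval unless it gets cut at a lower corner `(k, -p k)`, that is,
unless the trajectory from this corner reaches `G_n` directly. Over an interval of slopes of length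
`ℓ`, the vertical coordinate of the trajectory from a given corner, after `j + 1` strips passed
without collision, is one of at most `(ℓ / (2 p_k) + 2) * 3 ^ j` affine functions of `τ` with slope
`j + 1`. Hence, up to a term that vanishes as `n → ∞`, the slopes for which `G_n` gets cut fill at
most the proportion `∑ j, 3 ^ j * lam ^ (j + 1) / (j + 1) = -log (1 - 3 * lam) / 3` of the interval.
This is less than `1` for `lam < (1 - exp (-3)) / 3`, and then, by Lebesgue's density theorem, the
slopes for which `G_n` gets cut for all large `n` form a null set.
-/

section CircleRotation

variable {α : Type*} [AddCommGroup α] [LinearOrder α] [IsOrderedAddMonoid α] [Archimedean α]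
  {p : α} (hp : 0 < p)

lemma toIcoMod_mem_iff_exists_sub_zsmul_mem {c x : α} {s : Set α} (hs : s ⊆ Ico c (c + p)) :
    toIcoMod hp c x ∈ s ↔ ∃ n : ℤ, x - n • p ∈ s := by
  refine ⟨fun h => ⟨toIcoDiv hp c x, h⟩, fun ⟨n, h⟩ => ?_⟩
  rwa [← toIcoMod_sub_zsmul hp c x n, (toIcoMod_eq_self hp).2 (hs h)]

lemma exists_setOf_toIcoMod_add_mem_eq_Ico {a b c t : α} (hab : Ico a b ⊆ Ico c (c + p))
    (hc : toIcoMod hp c (c + t) ∉ Ico a b) :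
    ∃ d, {y ∈ Ico c (c + p) | toIcoMod hp c (y + t) ∈ Ico a b} = Ico d (d + (b - a)) := by
  obtain ⟨d, hd, q, hq⟩ : ∃ d ∈ Ico c (c + p), ∃ q : ℤ, d = a - t - q • p :=
    ⟨_, toIcoMod_mem_Ico hp c (a - t), _, rfl⟩
  have pullback (y : α) :
      toIcoMod hp c (y + t) ∈ Ico a b ↔ ∃ n : ℤ, y - n • p ∈ Ico d (d + (b - a)) := by
    rw [toIcoMod_mem_iff_exists_sub_zsmul_mem hp hab]
    refine (Equiv.addRight q).exists_congr fun n => ?_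
    have translate : y - (n + q) • p = y + t - n • p + (d - a) := by rw [hq, add_zsmul]; abel
    rw [Equiv.coe_addRight, translate, Set.add_mem_Ico_iff_left]
    simp
  have right_le : d + (b - a) ≤ c + p := by
    by_contra! hlt
    exact hc ((pullback c).2 ⟨-1, by simpa using ⟨hd.2.le, hlt⟩⟩)
  have hsub : Ico d (d + (b - a)) ⊆ Ico c (c + p) := Ico_subset_Ico hd.1 right_le
  refine ⟨d, Set.ext fun y => ⟨fun ⟨hy, h⟩ => ?_, fun h => ⟨hsub h, (pullback y).2 ⟨0, by simpa⟩⟩⟩⟩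
  rw [← (toIcoMod_eq_self hp).2 hy]
  exact (toIcoMod_mem_iff_exists_sub_zsmul_mem hp hsub).2 ((pullback y).1 h)

end CircleRotation

lemma exists_finset_toIcoMod_eq_add {α : Type*} [Field α] [LinearOrder α] [IsStrictOrderedRing α]
    [FloorRing α] {p : α} (hp : 0 < p) (c a b : α) :
    ∃ S : Finset α, S.card ≤ ⌈(b - a) / p⌉₊ + 1 ∧
      ∀ y ∈ Icc a b, ∃ s ∈ S, toIcoMod hp c y = y + s := by
  have div_mono : Monotone (toIcoDiv hp c) := fun x y hxy => by
    simp only [toIcoDiv_eq_floor]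
    gcongr
  have div_le : toIcoDiv hp c b ≤ toIcoDiv hp c a + ⌈(b - a) / p⌉₊ := by
    simp only [toIcoDiv_eq_floor]
    rw [← Int.floor_add_natCast]
    refine Int.floor_le_floor ?_
    calc (b - c) / p = (a - c) / p + (b - a) / p := by ring
      _ ≤ (a - c) / p + ⌈(b - a) / p⌉₊ := by gcongr; exact Nat.le_ceil _
  refine ⟨(Finset.Icc (toIcoDiv hp c a) (toIcoDiv hp c b)).image fun n : ℤ => -(n • p), ?_,
    fun y hy => ⟨_, Finset.mem_image_of_mem _ (Finset.mem_Icc.2 ⟨div_mono hy.1, div_mono hy.2⟩),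
      sub_eq_add_neg _ _⟩⟩
  refine Finset.card_image_le.trans ?_
  rw [Int.card_Icc]
  omega

lemma measure_eventually_mem_le_liminf {β : Type*} [MeasurableSpace β] (μ : Measure β)
    (s : ℕ → Set β) : μ {x | ∀ᶠ n in atTop, x ∈ s n} ≤ liminf (fun n => μ (s n)) atTop := by
  have eq_iUnion : {x | ∀ᶠ n in atTop, x ∈ s n} = ⋃ N, ⋂ n ≥ N, s n := by
    ext x; simp
  have mono : Monotone fun N => ⋂ n ≥ N, s n := fun M N hMN =>
    biInter_subset_biInter_left fun n hn => hMN.trans hn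
  rw [eq_iUnion, mono.measure_iUnion, liminf_eq_iSup_iInf_of_nat]
  exact iSup_mono fun N => le_iInf₂ fun n hn => measure_mono (biInter_subset_of_mem hn)

section Density

variable {β : Type*} [MetricSpace β] [MeasurableSpace β] [BorelSpace β]
  [SecondCountableTopology β] [HasBesicovitchCovering β] (μ : Measure β) [IsLocallyFiniteMeasure μ]

lemma measure_eq_zero_of_inter_closedBall_le {s : Set β} {c : ENNReal} (hc : c < 1)
    (h : ∀ x, ∀ r > 0, μ (s ∩ Metric.closedBall x r) ≤ c * μ (Metric.closedBall x r)) :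
    μ s = 0 := by
  rw [← Measure.restrict_eq_zero, ← ae_eq_bot, ← eventually_false_iff_eq_bot]
  filter_upwards [Besicovitch.ae_tendsto_measure_inter_div μ s] with x hx
  refine (le_of_tendsto hx ?_).not_gt hc
  filter_upwards [self_mem_nhdsWithin] with r hr
  exact ENNReal.div_le_of_le_mul (h x r hr)

lemma measure_eventually_mem_eq_zero {s : ℕ → Set β} {c : ENNReal} (hc : c < 1)
    (h : ∀ x, ∀ r > 0, liminf (fun n => μ (s n ∩ Metric.closedBall x r)) atTop ≤
      c * μ (Metric.closedBall x r)) :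
    μ {x | ∀ᶠ n in atTop, x ∈ s n} = 0 := by
  refine measure_eq_zero_of_inter_closedBall_le μ hc fun x r hr =>
    le_trans ?_ ((measure_eventually_mem_le_liminf μ _).trans (h x r hr))
  exact measure_mono fun y hy => hy.1.mono fun n hn => ⟨hn, hy.2⟩

end Density

lemma volume_setOf_mul_add_mem_Ico {m : ℝ} (hm : 0 < m) (c u v : ℝ) :
    volume {x | m * x + c ∈ Ico u v} = ENNReal.ofReal ((v - u) / m) := by
  have : {x | m * x + c ∈ Ico u v} = (m * ·) ⁻¹' ((· + c) ⁻¹' Ico u v) := rfl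
  rw [this, preimage_add_const_Ico, preimage_const_mul_Ico₀ _ _ hm, Real.volume_Ico]
  congr 1
  ring

lemma ae_restrict_Ioo_comp_tan {P : ℝ → Prop} (hP : ∀ᵐ x, P x) :
    ∀ᵐ θ ∂volume.restrict (Ioo (-(π / 2)) (π / 2)), P (tan θ) := by
  have hnull : volume (arctan '' {x | ¬ P x}) = 0 :=
    addHaar_image_eq_zero_of_differentiableOn_of_addHaar_eq_zero volume
      differentiable_arctan.differentiableOn hP
  filter_upwards [ae_restrict_of_ae (compl_mem_ae_iff.2 hnull),
    ae_restrict_mem measurableSet_Ioo] with θ hθ hI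
  by_contra hnot
  exact hθ ⟨tan θ, hnot, arctan_tan hI.1 hI.2⟩

lemma sum_pow_mul_pow_succ_div_le {q r : ℝ} (hq : 0 < q) (hr : 0 ≤ r) (hqr : q * r < 1) (n : ℕ) :
    ∑ j ∈ Finset.range n, q ^ j * r ^ (j + 1) / (j + 1) ≤ -log (1 - q * r) / q := by
  have hlog := (hasSum_pow_div_log_of_abs_lt_one
    (abs_lt.2 ⟨neg_one_lt_zero.trans_le (by positivity), hqr⟩)).div_const q
  convert! sum_le_hasSum (Finset.range n) (fun j _ => by positivity) hlog using 2 with j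
  field_simp
  ring

lemma mul_add_add_mem_Icc {α : Type*} [Field α] [LinearOrder α] [IsStrictOrderedRing α]
    {m c u v x : α} (hm : 1 ≤ m) (hx : m * x + c ∈ Icc u v) :
    m * x + c + x ∈ Icc (u + (u - c) / m) (u + (u - c) / m + 2 * (v - u)) := by
  have hm0 : 0 < m := zero_lt_one.trans_le hm
  have left_le : (u - c) / m ≤ x := (div_le_iff₀' hm0).2 (by linarith [hx.1])
  have le_right : x ≤ (u - c) / m + (v - u) := by
    calc x ≤ (v - c) / m := (le_div_iff₀' hm0).2 (by linarith [hx.2])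
      _ = (u - c) / m + (v - u) / m := by ring
      _ ≤ (u - c) / m + (v - u) := by gcongr; exact div_le_self (by linarith [hx.1, hx.2]) hm
  exact ⟨by linarith [hx.1], by linarith [hx.2]⟩

namespace StepBilliard

variable (B : StepBilliard)

lemma height_neg_natCast_succ (n : ℕ) : B.height (-((n + 1 : ℕ) : ℤ)) = B.p n := rfl

lemma Ico_neg_height_add_two_mul (m : ℤ) :
    Ico (-B.height m) (-B.height m + 2 * B.height m) = Ico (-B.height m) (B.height m) := by
  rw [two_mul, neg_add_cancel_left]

lemma wrap_mem_Ico (m : ℤ) (y : ℝ) : B.wrap m y ∈ Ico (-B.height m) (B.height m) := by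
  rw [← Ico_neg_height_add_two_mul]
  exact toIcoMod_mem_Ico _ _ _

lemma wrap_eq_self {m : ℤ} {y : ℝ} (hy : y ∈ Ico (-B.height m) (B.height m)) :
    B.wrap m y = y :=
  (toIcoMod_eq_self _).2 (by rwa [Ico_neg_height_add_two_mul])

/-- The vertical coordinate at `X = k + j` of the trajectory with slope `τ` which starts from
`(k, y)` and goes straight on through all walls, as if every strip were entered from the previous
one. -/
noncomputable def orbit (τ : ℝ) (k : ℕ) (y : ℝ) : ℕ → ℝ
  | 0 => y
  | j + 1 => B.wrap (k + j : ℕ) (orbit τ k y j + τ)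

/-- The trajectory with slope `τ` from `(k, y)` passes through the apertures `k, …, k + j`, one
after the other. -/
def Reaches (τ : ℝ) (k j : ℕ) (y : ℝ) : Prop :=
  ∀ i ≤ j, B.orbit τ k y i ∈ Ico (-B.p (k + i)) (B.p (k + i))

/-- The slopes for which the trajectory of some lower corner `(k, -p k)` with `k < n` passes
through all apertures up to the `n`-th one. -/
def cornerSlopes (n : ℕ) : Set ℝ :=
  {τ | ∃ j k, k + (j + 1) = n ∧ B.Reaches τ k (j + 1) (-B.p k)}

lemma cornerSlopes_succ_eq_biUnion (n : ℕ) : B.cornerSlopes (n + 1) =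
    ⋃ j ∈ Finset.range (n + 1), {τ | B.Reaches τ (n - j) (j + 1) (-B.p (n - j))} := by
  ext τ
  simp only [cornerSlopes, mem_iUnion, mem_ofPred_eq, exists_prop, Finset.mem_range]
  constructor
  · rintro ⟨j, k, hn, hreach⟩
    obtain rfl : k = n - j := by omega
    exact ⟨j, by omega, hreach⟩
  · exact fun ⟨j, hj, hreach⟩ => ⟨j, n - j, by omega, hreach⟩

section Orbit

variable {B} {τ y : ℝ} {k i j : ℕ}

lemma orbit_zero_left_succ : B.orbit τ 0 y (j + 1) = B.wrap j (B.orbit τ 0 y j + τ) := by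
  rw [orbit, Nat.zero_add]

lemma orbit_succ_eq_orbit_wrap :
    B.orbit τ k y (j + 1) = B.orbit τ (k + 1) (B.wrap k (y + τ)) j := by
  induction j with
  | zero => rfl
  | succ j ih => rw [orbit, ih, orbit, Nat.add_right_comm k 1 j, Nat.add_assoc k j 1]

lemma reaches_zero_iff : B.Reaches τ k 0 y ↔ y ∈ Ico (-B.p k) (B.p k) := by
  simp [Reaches, orbit]

lemma Reaches.mono (h : B.Reaches τ k j y) (hij : i ≤ j) : B.Reaches τ k i y :=
  fun l hl => h l (hl.trans hij)

lemma reaches_succ_iff : B.Reaches τ k (j + 1) y ↔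
    B.Reaches τ k j y ∧ B.orbit τ k y (j + 1) ∈ Ico (-B.p (k + (j + 1))) (B.p (k + (j + 1))) := by
  simp only [Reaches, Nat.le_succ_iff, or_imp, forall_and, forall_eq]

lemma reaches_succ_iff_wrap : B.Reaches τ k (j + 1) y ↔
    y ∈ Ico (-B.p k) (B.p k) ∧ B.Reaches τ (k + 1) j (B.wrap k (y + τ)) := by
  induction j with
  | zero => rw [reaches_succ_iff, reaches_zero_iff, reaches_zero_iff]; rfl
  | succ j ih =>
    rw [reaches_succ_iff, ih, reaches_succ_iff, and_assoc, orbit_succ_eq_orbit_wrap,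
      Nat.add_right_comm k 1, Nat.add_assoc k (j + 1)]

lemma exists_last_reaches (h0 : B.Reaches τ k 0 y) (h : ¬ B.Reaches τ k j y) :
    ∃ i < j, B.Reaches τ k i y ∧
      B.orbit τ k y (i + 1) ∉ Ico (-B.p (k + (i + 1))) (B.p (k + (i + 1))) := by
  obtain ⟨i, hi, hi'⟩ := Nat.exists_not_and_succ_of_not_zero_of_exists
    (p := fun i => ¬ B.Reaches τ k i y) (not_not.2 h0) ⟨j, h⟩
  rw [not_not] at hi
  exact ⟨i, not_le.1 fun hji => h (hi.mono hji), hi,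
    fun hmem => hi' (reaches_succ_iff.2 ⟨hi, hmem⟩)⟩

end Orbit

section Flow

variable {B} {θ t y : ℝ} {n : ℕ}

lemma cross_iterate_of_reaches (h : B.Reaches (tan θ) 0 n y) :
    (B.cross θ)^[n] (0, y) = ((n : ℤ), B.orbit (tan θ) 0 y n) := by
  induction n with
  | zero => rfl
  | succ n ih =>
    obtain ⟨hn, hmem⟩ := reaches_succ_iff.1 h
    rw [orbit_zero_left_succ, Nat.zero_add] at hmem
    rw [Function.iterate_succ_apply', ih hn, cross, if_neg fun hwall => hwall.2 hmem,
      orbit_zero_left_succ]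
    rfl

lemma cross_iterate_succ_of_notMem (h : B.Reaches (tan θ) 0 n y)
    (hwall : B.orbit (tan θ) 0 y (n + 1) ∉ Ico (-B.p (n + 1)) (B.p (n + 1))) :
    (B.cross θ)^[n + 1] (0, y) = (-((n + 1 : ℕ) : ℤ), B.orbit (tan θ) 0 y (n + 1)) := by
  rw [orbit_zero_left_succ] at hwall ⊢
  rw [Function.iterate_succ_apply', cross_iterate_of_reaches h, cross,
    if_pos ⟨Int.natCast_nonneg n, hwall⟩]
  rfl

lemma flow_zero_left : B.flow θ t (0, y) =
    ((((B.cross θ)^[⌊t * cos θ⌋₊] (0, y)).1 : ℝ) + (t * cos θ - ⌊t * cos θ⌋₊),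
      B.wrap ((B.cross θ)^[⌊t * cos θ⌋₊] (0, y)).1
        (((B.cross θ)^[⌊t * cos θ⌋₊] (0, y)).2 + (t * cos θ - ⌊t * cos θ⌋₊) * tan θ)) := by
  simp [flow]

lemma flow_natCast_div_cos (hθ : 0 < cos θ) : B.flow θ (n / cos θ) (0, y) =
    ((((B.cross θ)^[n] (0, y)).1 : ℝ),
      B.wrap ((B.cross θ)^[n] (0, y)).1 ((B.cross θ)^[n] (0, y)).2) := by
  simp [flow_zero_left, div_mul_cancel₀ _ hθ.ne']

lemma flow_fst_of_reaches (h : B.Reaches (tan θ) 0 ⌊t * cos θ⌋₊ y) :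
    (B.flow θ t (0, y)).1 = t * cos θ := by
  simp [flow_zero_left, cross_iterate_of_reaches h]

lemma flow_notMem_walls_of_reaches (hθ : 0 < cos θ) (ht : 0 < t)
    (h : B.Reaches (tan θ) 0 ⌊t * cos θ⌋₊ y) : B.flow θ t (0, y) ∉ B.walls := by
  have hpos : 0 < (B.flow θ t (0, y)).1 := by
    rw [flow_fst_of_reaches h]
    exact mul_pos ht hθ
  rintro ⟨-, hzero | ⟨k, -, hneg, -⟩⟩
  · exact hpos.ne' hzero
  · linarith [k.cast_nonneg (α := ℝ)]

lemma flow_mem_aperture_of_reaches (hθ : 0 < cos θ) (h : B.Reaches (tan θ) 0 n y) :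
    B.flow θ (n / cos θ) (0, y) ∈ B.aperture n := by
  have hmem := h n le_rfl
  rw [Nat.zero_add] at hmem
  rw [flow_natCast_div_cos hθ, cross_iterate_of_reaches h, B.wrap_eq_self hmem]
  exact ⟨Int.cast_natCast n, hmem⟩

lemma flow_mem_walls_of_notMem (hθ : 0 < cos θ) (h : B.Reaches (tan θ) 0 n y)
    (hwall : B.orbit (tan θ) 0 y (n + 1) ∉ Ico (-B.p (n + 1)) (B.p (n + 1))) :
    B.flow θ ((n + 1 : ℕ) / cos θ) (0, y) ∈ B.walls := by
  have hmem : B.orbit (tan θ) 0 y (n + 1) ∈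
      Ico (-B.height (-((n + 1 : ℕ) : ℤ))) (B.height (-((n + 1 : ℕ) : ℤ))) := by
    rw [orbit_zero_left_succ, height_neg_natCast_succ]
    exact B.wrap_mem_Ico n _
  rw [flow_natCast_div_cos hθ, cross_iterate_succ_of_notMem h hwall, B.wrap_eq_self hmem]
  refine ⟨?_, Or.inr ⟨n + 1, n.succ_pos, by simp, hwall⟩⟩
  simpa only [surface, mem_ofPred_eq, Int.floor_intCast] using hmem

lemma directSet_eq_setOf_reaches (hθ : 0 < cos θ) (n : ℕ) :
    B.directSet θ n = {y | B.Reaches (tan θ) 0 n y} := by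
  have reaches_zero {y : ℝ} : B.Reaches (tan θ) 0 0 y ↔ y ∈ Ico (-1) 1 := by
    rw [reaches_zero_iff, B.zero_eq_one]
  ext y
  constructor
  · rintro ⟨hy, t, ht, haperture, hwalls⟩
    have hs : 0 ≤ t * cos θ := mul_nonneg ht hθ.le
    by_cases hreach : B.Reaches (tan θ) 0 ⌊t * cos θ⌋₊ y
    · have hn : t * cos θ = n := (flow_fst_of_reaches hreach).symm.trans haperture.1
      rwa [hn, Nat.floor_natCast] at hreach
    · obtain ⟨i, hi, hri, hwall⟩ := exists_last_reaches (reaches_zero.2 hy) hreach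
      rw [Nat.zero_add] at hwall
      exact absurd (flow_mem_walls_of_notMem hθ hri hwall)
        (hwalls _ ⟨by positivity, (div_le_iff₀ hθ).2 ((Nat.le_floor_iff hs).1 hi)⟩)
  · refine fun h => ⟨reaches_zero.1 (h.mono n.zero_le), n / cos θ, by positivity,
      flow_mem_aperture_of_reaches hθ h, fun s hs => flow_notMem_walls_of_reaches hθ hs.1 ?_⟩
    exact h.mono (Nat.floor_le_of_le ((le_div_iff₀ hθ).1 hs.2))

end Flow

lemma exists_setOf_reaches_eq_Ico {τ : ℝ} {k j : ℕ} (h : τ ∉ B.cornerSlopes (k + j)) :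
    ∃ a, {y | B.Reaches τ k j y} = Ico a (a + 2 * B.p (k + j)) := by
  induction j generalizing k with
  | zero =>
    refine ⟨-B.p k, ?_⟩
    simp only [reaches_zero_iff, Nat.add_zero, ofPred_mem_eq]
    rw [two_mul, neg_add_cancel_left]
  | succ j ih =>
    obtain ⟨a, ha⟩ := ih (k := k + 1) (by rwa [Nat.add_right_comm, Nat.add_assoc])
    rw [Nat.add_right_comm, Nat.add_assoc] at ha
    have reaches_iff (y : ℝ) : B.Reaches τ k (j + 1) y ↔ y ∈ Ico (-B.p k) (-B.p k + 2 * B.p k) ∧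
        B.wrap k (y + τ) ∈ Ico a (a + 2 * B.p (k + (j + 1))) := by
      rw [reaches_succ_iff_wrap, ← ha, two_mul, neg_add_cancel_left]
      rfl
    have target_subset : Ico a (a + 2 * B.p (k + (j + 1))) ⊆
        Ico (-B.p k) (-B.p k + 2 * B.p k) := by
      rw [← ha, two_mul, neg_add_cancel_left]
      have hle : B.p (k + 1) ≤ B.p k := B.antitone k.le_succ
      exact fun y hy => Ico_subset_Ico (neg_le_neg hle) hle (hy 0 j.zero_le)
    have corner_notMem : B.wrap k (-B.p k + τ) ∉ Ico a (a + 2 * B.p (k + (j + 1))) := fun hmem =>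
      h ⟨j, k, rfl, (reaches_iff _).2 ⟨⟨le_rfl, by linarith [B.pos k]⟩, hmem⟩⟩
    obtain ⟨d, hd⟩ := exists_setOf_toIcoMod_add_mem_eq_Ico (mul_pos two_pos (B.pos k))
      target_subset corner_notMem
    refine ⟨d, ?_⟩
    rw [add_sub_cancel_left] at hd
    rw [← hd]
    exact Set.ext reaches_iff

end StepBilliard

lemma numIntervals_Ico {a b : ℝ} (h : a < b) : numIntervals (Ico a b) = 1 := by
  apply le_antisymm
  · exact iInf₂_le_of_le 1 ⟨fun _ => a, fun _ => b, fun _ => h, (iUnion_const _).symm⟩ (by simp)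
  · refine le_iInf₂ fun k ⟨u, v, _, hcover⟩ => ?_
    have hk : k ≠ 0 := by
      rintro rfl
      exact (nonempty_Ico.2 h).ne_empty (by simpa using hcover)
    exact_mod_cast Nat.one_le_iff_ne_zero.2 hk

namespace StepBilliard

variable (B : StepBilliard)

lemma numIntervals_directSet_eq_one {θ : ℝ} (hθ : 0 < cos θ) {n : ℕ}
    (h : tan θ ∉ B.cornerSlopes n) : numIntervals (B.directSet θ n) = 1 := by
  rw [← Nat.zero_add n] at h
  obtain ⟨a, ha⟩ := B.exists_setOf_reaches_eq_Ico h
  rw [directSet_eq_setOf_reaches hθ, ha]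
  exact numIntervals_Ico (by linarith [B.pos (0 + n)])

lemma exists_finset_orbit_eq_mul_add (k j : ℕ) (y a b : ℝ) :
    ∃ S : Finset ℝ, S.card ≤ (⌈(b - a) / (2 * B.p k)⌉₊ + 1) * 3 ^ j ∧
      ∀ τ ∈ Icc a b, B.Reaches τ k j y →
        ∃ c ∈ S, B.orbit τ k y (j + 1) = ((j + 1 : ℕ) : ℝ) * τ + c := by
  induction j with
  | zero =>
    obtain ⟨S, hcard, hS⟩ := exists_finset_toIcoMod_eq_add (mul_pos two_pos (B.pos k)) (-B.p k)
      (y + a) (y + b)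
    rw [add_sub_add_left_eq_sub] at hcard
    refine ⟨S.image (y + ·), Finset.card_image_le.trans (by rwa [pow_zero, mul_one]),
      fun τ hτ _ => ?_⟩
    obtain ⟨s, hs, hwrap⟩ := hS (y + τ) ⟨by linarith [hτ.1], by linarith [hτ.2]⟩
    exact ⟨y + s, Finset.mem_image_of_mem _ hs, hwrap.trans (by push_cast; ring)⟩
  | succ j ih =>
    obtain ⟨S, hcard, hS⟩ := ih
    set P := B.p (k + (j + 1))
    have hP : 0 < P := B.pos _
    -- On the branch `(j + 1) τ + c ∈ [-P, P)`, of length at most `2 P` in `τ`, the value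
    -- `(j + 1) τ + c + τ` varies by at most `4 P`, so it is wrapped in at most three ways.
    let start : ℝ → ℝ := fun c => -P + (-P - c) / (j + 1 : ℕ)
    choose W hWcard hW using fun c => exists_finset_toIcoMod_eq_add (mul_pos two_pos hP) (-P)
      (start c) (start c + 2 * (P - -P))
    have three_wraps (c : ℝ) : (W c).card ≤ 3 := by
      refine (hWcard c).trans_eq ?_
      rw [add_sub_cancel_left, show 2 * (P - -P) / (2 * P) = (2 : ℕ) by field_simp; norm_num,
        Nat.ceil_natCast]
    classical
    refine ⟨S.biUnion fun c => (W c).image (c + ·), ?_, fun τ hτ hreach => ?_⟩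
    · rw [pow_succ, ← mul_assoc]
      exact (Finset.card_biUnion_le_card_mul S _ 3 fun c _ =>
        Finset.card_image_le.trans (three_wraps c)).trans (Nat.mul_le_mul_right 3 hcard)
    · obtain ⟨hreach, hmem⟩ := reaches_succ_iff.1 hreach
      obtain ⟨c, hc, horbit⟩ := hS τ hτ hreach
      rw [horbit] at hmem
      obtain ⟨w, hw, hwrap⟩ :=
        hW c _ (mul_add_add_mem_Icc (by simp) (Ico_subset_Icc_self hmem))
      refine ⟨c + w, Finset.mem_biUnion.2 ⟨c, hc, Finset.mem_image_of_mem _ hw⟩, ?_⟩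
      rw [orbit, horbit]
      exact hwrap.trans (by push_cast; ring)

lemma volume_setOf_reaches_inter_Icc_le (k j : ℕ) (y : ℝ) {a b : ℝ} (hab : a ≤ b) :
    volume ({τ | B.Reaches τ k (j + 1) y} ∩ Icc a b) ≤
      ENNReal.ofReal (((b - a) / (2 * B.p k) + 2) * 3 ^ j * (2 * B.p (k + (j + 1)) / (j + 1))) := by
  obtain ⟨S, hcard, hS⟩ := B.exists_finset_orbit_eq_mul_add k j y a b
  set q := B.p (k + (j + 1))
  have card_le : (S.card : ℝ) ≤ ((b - a) / (2 * B.p k) + 2) * 3 ^ j := by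
    have ceil_add_one_le : (⌈(b - a) / (2 * B.p k)⌉₊ : ℝ) + 1 ≤ (b - a) / (2 * B.p k) + 2 := by
      linarith [Nat.ceil_lt_add_one
        (div_nonneg (sub_nonneg.2 hab) (mul_pos two_pos (B.pos k)).le)]
    calc (S.card : ℝ) ≤ (⌈(b - a) / (2 * B.p k)⌉₊ + 1) * 3 ^ j := by exact_mod_cast hcard
      _ ≤ ((b - a) / (2 * B.p k) + 2) * 3 ^ j := by gcongr
  have subset_branches : {τ | B.Reaches τ k (j + 1) y} ∩ Icc a b ⊆
      ⋃ c ∈ S, {τ | ((j + 1 : ℕ) : ℝ) * τ + c ∈ Ico (-q) q} := by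
    rintro τ ⟨hreach, hτ⟩
    obtain ⟨hreach, hmem⟩ := reaches_succ_iff.1 hreach
    obtain ⟨c, hc, horbit⟩ := hS τ hτ hreach
    rw [horbit] at hmem
    exact mem_iUnion₂.2 ⟨c, hc, hmem⟩
  calc volume ({τ | B.Reaches τ k (j + 1) y} ∩ Icc a b)
      ≤ ∑ c ∈ S, volume {τ | ((j + 1 : ℕ) : ℝ) * τ + c ∈ Ico (-q) q} :=
        (measure_mono subset_branches).trans (measure_biUnion_finset_le _ _)
    _ = S.card * ENNReal.ofReal (2 * q / (j + 1)) := by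
        simp only [volume_setOf_mul_add_mem_Ico (Nat.cast_pos.2 j.succ_pos), Finset.sum_const,
          nsmul_eq_mul, sub_neg_eq_add, ← two_mul]
        rw [Nat.cast_succ]
    _ = ENNReal.ofReal (S.card * (2 * q / (j + 1))) := by
        rw [ENNReal.ofReal_mul (Nat.cast_nonneg _), ENNReal.ofReal_natCast]
    _ ≤ _ := by
        have hq : 0 < q := B.pos _
        gcongr

section GeometricDecay

variable {B} {lam : ℝ} (hp : ∀ n, B.p (n + 1) ≤ lam * B.p n)
include hp

lemma pos_of_p_succ_le : 0 < lam :=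
  pos_of_mul_pos_left ((B.pos 1).trans_le (hp 0)) (B.pos 0).le

lemma p_add_le_pow_mul (k j : ℕ) : B.p (k + j) ≤ lam ^ j * B.p k := by
  have hlam := pos_of_p_succ_le hp
  induction j with
  | zero => simp
  | succ j ih =>
    calc B.p (k + (j + 1)) ≤ lam * B.p (k + j) := hp _
      _ ≤ lam * (lam ^ j * B.p k) := by gcongr
      _ = lam ^ (j + 1) * B.p k := by ring

lemma volume_setOf_reaches_inter_Icc_le_of_p_succ_le (k j : ℕ) (y : ℝ) {a b : ℝ} (hab : a ≤ b) :
    volume ({τ | B.Reaches τ k (j + 1) y} ∩ Icc a b) ≤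
      ENNReal.ofReal ((b - a) * (3 ^ j * lam ^ (j + 1) / (j + 1)) +
        4 * lam ^ (k + (j + 1)) * 3 ^ j) := by
  refine (B.volume_setOf_reaches_inter_Icc_le k j y hab).trans (ENNReal.ofReal_le_ofReal ?_)
  set q := B.p (k + (j + 1))
  have hk := B.pos k
  have hq : 0 < q := B.pos _
  have ratio_le : q / B.p k ≤ lam ^ (j + 1) := (div_le_iff₀ hk).2 (p_add_le_pow_mul hp k (j + 1))
  have q_le : q ≤ lam ^ (k + (j + 1)) := by
    simpa [B.zero_eq_one] using p_add_le_pow_mul hp 0 (k + (j + 1))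
  have q_div_le : q / (j + 1) ≤ lam ^ (k + (j + 1)) :=
    (div_le_self hq.le (le_add_of_nonneg_left j.cast_nonneg)).trans q_le
  calc ((b - a) / (2 * B.p k) + 2) * 3 ^ j * (2 * q / (j + 1))
      = (b - a) * (3 ^ j * (q / B.p k) / (j + 1)) + 4 * (q / (j + 1)) * 3 ^ j := by
        field_simp
        ring
    _ ≤ _ := by gcongr

lemma volume_cornerSlopes_inter_Icc_le (hlam : 3 * lam < 1) (n : ℕ) {a b : ℝ} (hab : a ≤ b) :
    volume (B.cornerSlopes (n + 1) ∩ Icc a b) ≤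
      ENNReal.ofReal (-log (1 - 3 * lam) / 3 * (b - a) + 2 * (3 * lam) ^ (n + 1)) := by
  have hlam0 := pos_of_p_succ_le hp
  let bound : ℕ → ℝ := fun j =>
    (b - a) * (3 ^ j * lam ^ (j + 1) / (j + 1)) + 4 * lam ^ (n + 1) * 3 ^ j
  have volume_le : ∀ j ∈ Finset.range (n + 1),
      volume ({τ | B.Reaches τ (n - j) (j + 1) (-B.p (n - j))} ∩ Icc a b) ≤
        ENNReal.ofReal (bound j) := by
    intro j hj
    have hn : n - j + (j + 1) = n + 1 := by
      rw [← Nat.add_assoc, Nat.sub_add_cancel (Finset.mem_range_succ_iff.1 hj)]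
    simpa only [hn] using
      volume_setOf_reaches_inter_Icc_le_of_p_succ_le hp (n - j) j (-B.p (n - j)) hab
  have sum_bound_le : ∑ j ∈ Finset.range (n + 1), bound j ≤
      -log (1 - 3 * lam) / 3 * (b - a) + 2 * (3 * lam) ^ (n + 1) := by
    have sum_three_pow_le : ∑ j ∈ Finset.range (n + 1), (3 : ℝ) ^ j ≤ 3 ^ (n + 1) / 2 := by
      rw [geom_sum_eq (by norm_num)]
      linarith
    calc ∑ j ∈ Finset.range (n + 1), bound j
        = (∑ j ∈ Finset.range (n + 1), 3 ^ j * lam ^ (j + 1) / (j + 1)) * (b - a) +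
            4 * lam ^ (n + 1) * ∑ j ∈ Finset.range (n + 1), 3 ^ j := by
          rw [Finset.sum_add_distrib, ← Finset.mul_sum, ← Finset.mul_sum, mul_comm (b - a)]
      _ ≤ -log (1 - 3 * lam) / 3 * (b - a) + 4 * lam ^ (n + 1) * (3 ^ (n + 1) / 2) := by
          gcongr
          exact sum_pow_mul_pow_succ_div_le three_pos hlam0.le hlam _
      _ = _ := by ring
  calc volume (B.cornerSlopes (n + 1) ∩ Icc a b)
      ≤ ∑ j ∈ Finset.range (n + 1), ENNReal.ofReal (bound j) := by
        rw [cornerSlopes_succ_eq_biUnion, iUnion₂_inter]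
        exact (measure_biUnion_finset_le _ _).trans (Finset.sum_le_sum volume_le)
    _ = ENNReal.ofReal (∑ j ∈ Finset.range (n + 1), bound j) :=
        (ENNReal.ofReal_sum_of_nonneg fun j _ => by positivity).symm
    _ ≤ _ := ENNReal.ofReal_le_ofReal sum_bound_le

lemma liminf_volume_cornerSlopes_inter_Icc_le (hlam : 3 * lam < 1) {a b : ℝ} (hab : a ≤ b) :
    liminf (fun n => volume (B.cornerSlopes n ∩ Icc a b)) atTop ≤
      ENNReal.ofReal (-log (1 - 3 * lam) / 3) * volume (Icc a b) := by
  have hpow : Tendsto (fun n : ℕ => (3 * lam) ^ (n + 1)) atTop (𝓝 0) :=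
    (tendsto_pow_atTop_nhds_zero_of_lt_one (by linarith [pos_of_p_succ_le hp]) hlam).comp
      (tendsto_add_atTop_nat 1)
  have hbound := ENNReal.tendsto_ofReal
    ((hpow.const_mul 2).const_add (-log (1 - 3 * lam) / 3 * (b - a)))
  rw [mul_zero, add_zero, ENNReal.ofReal_mul' (sub_nonneg.2 hab), ← Real.volume_Icc] at hbound
  rw [← liminf_nat_add _ 1, ← hbound.liminf_eq]
  exact liminf_le_liminf (.of_forall fun n => volume_cornerSlopes_inter_Icc_le hp hlam n hab)

lemma ae_frequently_notMem_cornerSlopes (hlam : lam < (1 - exp (-3)) / 3) :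
    ∀ᵐ τ, ∃ᶠ n in atTop, τ ∉ B.cornerSlopes n := by
  have three_mul_lt : 3 * lam < 1 := by linarith [exp_pos (-3)]
  have hlog : -3 < log (1 - 3 * lam) := (lt_log_iff_exp_lt (by linarith)).2 (by linarith)
  have proportion_lt : ENNReal.ofReal (-log (1 - 3 * lam) / 3) < 1 :=
    ENNReal.ofReal_lt_one.2 (by linarith)
  have hnull := measure_eventually_mem_eq_zero volume proportion_lt fun x r (hr : 0 < r) => by
    rw [Real.closedBall_eq_Icc]
    exact liminf_volume_cornerSlopes_inter_Icc_le hp three_mul_lt (by linarith)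
  simpa only [ae_iff, not_frequently, not_not] using hnull

end GeometricDecay

end StepBilliard

theorem mainTheorem2_general (B : StepBilliard) {lam : ℝ} (hlam : lam < (1 - exp (-3)) / 3)
    (hp : ∀ n : ℕ, B.p (n + 1) ≤ lam * B.p n) :
    ∀ᵐ θ ∂(volume.restrict (Ioo (0 : ℝ) (π / 2))),
      ∃ nj : ℕ → ℕ, StrictMono nj ∧
        ∀ j : ℕ, numIntervals (B.directSet θ (nj j)) = 1 := by
  have quadrant_subset : Ioo 0 (π / 2) ⊆ Ioo (-(π / 2)) (π / 2) :=
    Ioo_subset_Ioo_left (by linarith [pi_pos])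
  have tan_frequently := ae_restrict_of_ae_restrict_of_subset quadrant_subset
    (ae_restrict_Ioo_comp_tan (StepBilliard.ae_frequently_notMem_cornerSlopes hp hlam))
  filter_upwards [tan_frequently, ae_restrict_mem measurableSet_Ioo] with θ hfreq hθ
  obtain ⟨nj, hmono, hnj⟩ := extraction_of_frequently_atTop hfreq
  exact ⟨nj, hmono, fun j =>
    B.numIntervals_directSet_eq_one (cos_pos_of_mem_Ioo (quadrant_subset hθ)) (hnj j)⟩

lemma sqrt_six_sub_one_div_five_lt : (√6 - 1) / 5 < (1 - exp (-3)) / 3 := by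
  have sqrt_le : √6 ≤ 49 / 20 := sqrt_le_iff.2 (by norm_num)
  have le_exp : 17 / 2 ≤ exp 3 := by
    linarith [quadratic_le_exp_of_nonneg (x := 3) (by norm_num)]
  have exp_neg_le : exp (-3) ≤ 2 / 17 := by
    simpa [exp_neg] using inv_anti₀ (by norm_num) le_exp
  linarith

theorem mainTheorem2 (B : StepBilliard) (lam : ℝ) (hlam0 : 0 < lam)
    (hlam : lam < (Real.sqrt 6 - 1) / 5) (hp : ∀ n : ℕ, B.p (n + 1) ≤ lam * B.p n) :
    ∀ᵐ θ ∂(volume.restrict (Ioo (0 : ℝ) (π / 2))),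
      ∃ nj : ℕ → ℕ, StrictMono nj ∧
        ∀ j : ℕ, numIntervals (B.directSet θ (nj j)) = 1 :=
  mainTheorem2_general B (hlam.trans sqrt_six_sub_one_div_five_lt) hp
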